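/- For $n\ge 0$ let $\mathfrak S_n$ be the symmetric group on $\{1,\dots,n\}$, generated by the adjacent transpositions $s_i=(i\;\,i+1)$, $1\le i\le n-1$. For $\pi\in\mathfrak S_n$ let $\ell(\pi)$ be the least $k$ such that $\pi=s_{i_1}\cdots s_{i_k}$ for some $i_1,\dots,i_k$, and let $R(\pi)$ be the set of reduced words of $\pi$, i.e. of the words $i_1\cdots i_k$ with $k=\ell(\pi)$ and $\pi=s_{i_1}\cdots s_{i_k}$. Let $G_\pi$ be the graph with vertex set $R(\pi)$ in which two words are adjacent if they differ by a commutation move (switching two adjacent letters $i,j$ with $|i-j|>1$) or by a long braid move (exchanging $j(j+1)j$ and $(j+1)j(j+1)$ on consecutive positions). Let $C_\pi$ be the simple graph obtained from $G_\pi$ by contracting all commutation edges, and $B_\pi$ the simple graph obtained from $G_\pi$ by contracting all long braid edges. All these graphs are connected; $\operatorname{diam}$ denotes the maximal distance between two vertices. Let $a\ge 0$, let $\alpha=\alpha_1\cdots\alpha_a\in\mathfrak S_a$ (in one-line notation), and let $\pi=21[\alpha,1]\in\mathfrak S_{a+1}$ be the permutation with one-line notation $(\alpha_1+1)(\alpha_2+1)\cdots(\alpha_a+1)\,1$.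 Then \begin{enumerate} \item[(i)] $\operatorname{diam}(G_\pi)=\operatorname{diam}(G_\alpha)+\ell(\alpha)(a-1)$, \item[(ii)] $\operatorname{diam}(C_\pi)=\operatorname{diam}(C_\alpha)+\ell(\alpha)$, \item[(iii)] $\operatorname{diam}(B_\pi)=\operatorname{diam}(B_\alpha)+\ell(\alpha)(a-2)$. \end{enumerate} -/

import Mathlib

namespace ReducedWords

/-- The simple reflection of `𝔖ₙ`, acting on `Fin n = {0, …, n-1}`, that interchanges `i` and
`i + 1`. It is only used for `i + 1 < n`; letters are numbered from `0`. -/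
def simpleReflection (n i : ℕ) : Equiv.Perm (Fin n) :=
  if h : i + 1 < n then Equiv.swap ⟨i, Nat.lt_of_succ_lt h⟩ ⟨i + 1, h⟩ else 1

/-- `w = i₁ i₂ ⋯ iₖ` is a word in the simple reflections of `𝔖ₙ` with
`s_{i₁} s_{i₂} ⋯ s_{iₖ} = π`. -/
def IsWordFor {n : ℕ} (π : Equiv.Perm (Fin n)) (w : List ℕ) : Prop :=
  (∀ i ∈ w, i + 1 < n) ∧ (w.map (simpleReflection n)).prod = π

/-- The set `R(π)` of reduced words for `π`: the words for `π` of minimal length. -/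
def R {n : ℕ} (π : Equiv.Perm (Fin n)) : Set (List ℕ) :=
  {w | IsWordFor π w ∧ ∀ w', IsWordFor π w' → w.length ≤ w'.length}

/-- The length `ℓ(π)`: the least number of letters of a word for `π`. -/
noncomputable def ell {n : ℕ} (π : Equiv.Perm (Fin n)) : ℕ :=
  sInf {k | ∃ w, IsWordFor π w ∧ w.length = k}

/-- A commutation move switches two adjacent letters `i`, `j` with `|i - j| > 1`. -/
def CommutationMove (w w' : List ℕ) : Prop :=
  ∃ (x y : List ℕ) (i j : ℕ), (i + 1 < j ∨ j + 1 < i) ∧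
    w = x ++ [i, j] ++ y ∧ w' = x ++ [j, i] ++ y

/-- A long braid move exchanges consecutive occurrences of `j (j+1) j` and `(j+1) j (j+1)`. -/
def LongBraidMove (w w' : List ℕ) : Prop :=
  ∃ (x y : List ℕ) (j : ℕ),
    (w = x ++ [j, j + 1, j] ++ y ∧ w' = x ++ [j + 1, j, j + 1] ++ y) ∨
    (w = x ++ [j + 1, j, j + 1] ++ y ∧ w' = x ++ [j, j + 1, j] ++ y)

/-- The graph on `R(π)` whose edges are the commutation moves. -/
def commutationEdges {n : ℕ} (π : Equiv.Perm (Fin n)) : SimpleGraph (R π) where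
  Adj u v := CommutationMove u v
  symm := ⟨by
    rintro u v ⟨x, y, i, j, h, hu, hv⟩
    exact ⟨x, y, j, i, h.symm, hv, hu⟩⟩
  loopless := ⟨by
    rintro u ⟨x, y, i, j, h, hu, hv⟩
    have := hu.symm.trans hv
    simp at this
    omega⟩

/-- The graph on `R(π)` whose edges are the long braid moves. -/
def longBraidEdges {n : ℕ} (π : Equiv.Perm (Fin n)) : SimpleGraph (R π) where
  Adj u v := LongBraidMove u v
  symm := ⟨by
    rintro u v ⟨x, y, j, ⟨hu, hv⟩ | ⟨hu, hv⟩⟩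
    · exact ⟨x, y, j, Or.inr ⟨hv, hu⟩⟩
    · exact ⟨x, y, j, Or.inl ⟨hv, hu⟩⟩⟩
  loopless := ⟨by
    rintro u ⟨x, y, j, ⟨hu, hv⟩ | ⟨hu, hv⟩⟩ <;>
    · have := hu.symm.trans hv
      simp at this⟩

/-- The graph `G_π` on `R(π)`: its edges are the commutation edges and the long braid edges. -/
def G {n : ℕ} (π : Equiv.Perm (Fin n)) : SimpleGraph (R π) :=
  commutationEdges π ⊔ longBraidEdges π

/-- The graph `C_π`: `G_π` contracted along the commutation edges. Its vertices are the commutation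
classes, and two different classes are adjacent iff an edge of `G_π` joins a member of one to a
member of the other (`SimpleGraph.map` discards loops). -/
def C {n : ℕ} (π : Equiv.Perm (Fin n)) : SimpleGraph (commutationEdges π).ConnectedComponent :=
  (G π).map (commutationEdges π).connectedComponentMk

/-- The graph `B_π`: `G_π` contracted along the long braid edges; its vertices are the braid
classes. -/
def B {n : ℕ} (π : Equiv.Perm (Fin n)) : SimpleGraph (longBraidEdges π).ConnectedComponent :=
  (G π).map (longBraidEdges π).connectedComponentMk

/-- The inflation `21[α, β]`: in one-line notation, the entries of `α` raised by `|β|`, followed by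
the entries of `β`. -/
def inflation21 {a b : ℕ} (α : Equiv.Perm (Fin a)) (β : Equiv.Perm (Fin b)) :
    Equiv.Perm (Fin (a + b)) :=
  finSumFinEquiv.symm.trans <| (Equiv.sumCongr α β).trans <|
    (Equiv.sumComm (Fin a) (Fin b)).trans <| finSumFinEquiv.trans <| finCongr (Nat.add_comm b a)

theorem inflation21_castAdd {a b : ℕ} (α : Equiv.Perm (Fin a)) (β : Equiv.Perm (Fin b))
    (i : Fin a) : (inflation21 α β (Fin.castAdd b i) : ℕ) = b + α i := by
  simp [inflation21, Nat.add_comm]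

theorem inflation21_natAdd {a b : ℕ} (α : Equiv.Perm (Fin a)) (β : Equiv.Perm (Fin b))
    (i : Fin b) : (inflation21 α β (Fin.natAdd a i) : ℕ) = β i := by
  simp [inflation21]

end ReducedWords

/-!
If a commutation move costs `c` and a long braid move costs `b`, then the distances of `G_π`, `C_π`
and `B_π` are the cheapest costs of move sequences for `(c, b) = (1, 1)`, `(0, 1)` and `(1, 0)`, so
it is enough to show that inflating `α` to `21[α, 1]` raises the weighted diameter by
`L = ℓ(α) (c (a - 2) + b)`.

In the wiring diagram of a reduced word of `21[α, 1]`, the wire of the smallest value starts at the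
first position, ends at the last one and never moves back; deleting it leaves a reduced word of `α`.
Pulling the crossings of this wire behind all other letters has a cost `x`, and pulling them in
front of all other letters then costs `L - x`. Given two words, with costs `x` and `y`, change one
into the other with the wire pulled to the back or to the front: apart from the moves in `α`, the
two routes cost `x + y` and `2 L - (x + y)`, so one of them costs at most `L`. Conversely, a move
either survives the deletion of the wire and preserves `x`, or it disappears and changes `x` by at
most its own cost. Since `x` is `0` for words with the wire at the back and `L` for words with the
wire at the front, passing from one kind to the other costs `L` on top of the moves in `α`.

Pulling the wire of the smallest value to the back also shows, by induction on the number of wires,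
that any two reduced words of a permutation are joined by moves.
-/

namespace ReducedWords

/-! ### Paths with costs -/

/-- Paths in a relation whose steps carry costs: if `step k u v` is a step from `u` to `v` of
cost `k`, then `CostPath step k u v` says that `v` is reached from `u` by steps of total cost
`k`. -/
inductive CostPath {X : Type*} (step : ℕ → X → X → Prop) : ℕ → X → X → Prop
  | refl (u : X) : CostPath step 0 u u
  | tail {k l : ℕ} {u v w : X} :
      CostPath step k u v → step l v w → CostPath step (k + l) u w

namespace CostPath

variable {X Y : Type*} {step : ℕ → X → X → Prop} {step' : ℕ → Y → Y → Prop} {k l : ℕ} {u v w : X}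

theorem cast (p : CostPath step k u v) (h : k = l) : CostPath step l u v := h ▸ p

theorem single (h : step k u v) : CostPath step k u v :=
  ((refl u).tail h).cast (Nat.zero_add k)

theorem trans (p : CostPath step k u v) (q : CostPath step l v w) :
    CostPath step (k + l) u w := by
  induction q with
  | refl => exact p
  | tail _ h ih => exact ((ih p).tail h).cast (Nat.add_assoc ..)

theorem symm (hstep : ∀ ⦃k u v⦄, step k u v → step k v u) (p : CostPath step k u v) :
    CostPath step k v u := by
  induction p with
  | refl => exact refl _
  | tail _ h ih => exact ((single (hstep h)).trans ih).cast (Nat.add_comm ..)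

theorem map (f : X → Y) (hf : ∀ ⦃k u v⦄, step k u v → step' k (f u) (f v))
    (p : CostPath step k u v) : CostPath step' k (f u) (f v) := by
  induction p with
  | refl => exact refl _
  | tail _ h ih => exact ih.tail (hf h)

theorem mem_of_mem {S : Set X} (hS : ∀ ⦃k u v⦄, step k u v → u ∈ S → v ∈ S)
    (p : CostPath step k u v) (hu : u ∈ S) : v ∈ S := by
  induction p with
  | refl => exact hu
  | tail _ h ih => exact hS h (ih hu)

theorem exists_map_of_potential (f : X → Y) (φ : X → ℕ)
    (hf : ∀ ⦃k u v⦄, step k u v → ∃ l, CostPath step' l (f u) (f v) ∧ l + φ v ≤ k + φ u)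
    (p : CostPath step k u v) : ∃ l, CostPath step' l (f u) (f v) ∧ l + φ v ≤ k + φ u := by
  induction p with
  | refl => exact ⟨0, refl _, le_rfl⟩
  | tail _ h ih =>
    obtain ⟨l₁, p₁, h₁⟩ := ih
    obtain ⟨l₂, p₂, h₂⟩ := hf h
    exact ⟨l₁ + l₂, p₁.trans p₂, by omega⟩

end CostPath

/-- `D` is the diameter of `S` with respect to path costs: any two points of `S` are joined by a
path of cost at most `D`, and for some two points of `S` no path is cheaper than `D`. -/
def IsCostDiam {X : Type*} (step : ℕ → X → X → Prop) (S : Set X) (D : ℕ) : Prop :=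
  (∀ u ∈ S, ∀ v ∈ S, ∃ k ≤ D, CostPath step k u v) ∧
    ∃ u ∈ S, ∃ v ∈ S, ∀ k, CostPath step k u v → D ≤ k

theorem exists_isCostDiam {X : Type*} {step : ℕ → X → X → Prop} {S : Set X} (hfin : S.Finite)
    (hne : S.Nonempty) (hconn : ∀ u ∈ S, ∀ v ∈ S, ∃ k, CostPath step k u v) :
    ∃ D, IsCostDiam step S D := by
  classical
  have hpath : ∀ p : S × S, ∃ k, CostPath step k p.1 p.2 :=
    fun p => hconn p.1 p.1.2 p.2 p.2.2
  have := hfin.to_subtype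
  have := hne.to_subtype
  obtain ⟨p, hp⟩ := Finite.exists_max fun p => Nat.find (hpath p)
  refine ⟨Nat.find (hpath p), fun u hu v hv => ?_, p.1, p.1.2, p.2, p.2.2, fun k hk => ?_⟩
  · exact ⟨_, hp (⟨u, hu⟩, ⟨v, hv⟩), Nat.find_spec (hpath (⟨u, hu⟩, ⟨v, hv⟩))⟩
  · exact Nat.find_min' _ hk

/-- The graph `K` realizes the path costs on `S` through the surjection `f`: distances in `K` are
the least costs of paths, and the points that `f` identifies are joined by paths of cost `0`. -/
structure Realizes {X V : Type*} (step : ℕ → X → X → Prop) {S : Set X} (K : SimpleGraph V)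
    (f : S → V) : Prop where
  surjective : Function.Surjective f
  mem_of_step : ∀ ⦃k u v⦄, step k u v → u ∈ S → v ∈ S
  edist_le_of_step : ∀ ⦃k⦄ ⦃u v : S⦄, step k u v → K.edist (f u) (f v) ≤ k
  costPath_of_eq : ∀ ⦃u v : S⦄, f u = f v → CostPath step 0 (u : X) v
  costPath_of_adj : ∀ ⦃u v : S⦄, K.Adj (f u) (f v) → CostPath step 1 (u : X) v

namespace Realizes

variable {X V : Type*} {step : ℕ → X → X → Prop} {S : Set X} {K : SimpleGraph V} {f : S → V}

theorem edist_le (h : Realizes step K f) {k : ℕ} {u v : X} (p : CostPath step k u v) (hu : u ∈ S)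
    (hv : v ∈ S) : K.edist (f ⟨u, hu⟩) (f ⟨v, hv⟩) ≤ k := by
  induction p with
  | refl => simp
  | @tail k l u v w p hvw ih =>
    have hv' : v ∈ S := p.mem_of_mem h.mem_of_step hu
    calc K.edist (f ⟨u, hu⟩) (f ⟨w, hv⟩)
        ≤ K.edist (f ⟨u, hu⟩) (f ⟨v, hv'⟩) + K.edist (f ⟨v, hv'⟩) (f ⟨w, hv⟩) :=
          K.edist_triangle
      _ ≤ k + l := add_le_add (ih hu hv') (h.edist_le_of_step hvw)
      _ = (k + l : ℕ) := (Nat.cast_add k l).symm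

theorem costPath_of_walk (h : Realizes step K f) {u v : S} {x y : V} (p : K.Walk x y)
    (hx : f u = x) (hy : f v = y) : CostPath step p.length (u : X) v := by
  induction p generalizing u with
  | nil => exact h.costPath_of_eq (hx.trans hy.symm)
  | @cons x z y hxz p ih =>
    obtain ⟨w, rfl⟩ := h.surjective z
    exact ((h.costPath_of_adj (hx ▸ hxz)).trans (ih rfl hy)).cast (Nat.add_comm ..)

theorem ediam_eq (h : Realizes step K f) {D : ℕ} (hD : IsCostDiam step S D) : K.ediam = D := by
  obtain ⟨hle, u, hu, v, hv, huv⟩ := hD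
  refine le_antisymm (SimpleGraph.ediam_le_of_edist_le fun x y => ?_) ?_
  · obtain ⟨⟨u, hu⟩, rfl⟩ := h.surjective x
    obtain ⟨⟨v, hv⟩, rfl⟩ := h.surjective y
    obtain ⟨k, hk, p⟩ := hle u hu v hv
    exact (h.edist_le p hu hv).trans (by exact_mod_cast hk)
  · refine le_trans (le_iInf fun p => ?_)
      (SimpleGraph.edist_le_ediam (u := f ⟨u, hu⟩) (v := f ⟨v, hv⟩))
    exact_mod_cast huv _ (h.costPath_of_walk p rfl rfl)

theorem connected_and_diam_eq (h : Realizes step K f) {D : ℕ} (hD : IsCostDiam step S D) :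
    K.Connected ∧ K.diam = D := by
  have hdiam : K.ediam = D := h.ediam_eq hD
  obtain ⟨u, hu, -⟩ := hD.2
  have : Nonempty V := ⟨f ⟨u, hu⟩⟩
  exact ⟨SimpleGraph.connected_of_ediam_ne_top (hdiam ▸ ENat.natCast_ne_top D),
    by rw [SimpleGraph.diam, hdiam, ENat.toNat_natCast]⟩

theorem of_adj_iff {K : SimpleGraph S} (hS : ∀ ⦃k u v⦄, step k u v → u ∈ S → v ∈ S)
    (hstep : ∀ k (u v : S), step k u v ↔ k = 1 ∧ K.Adj u v) : Realizes step K id where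
  surjective := Function.surjective_id
  mem_of_step := hS
  edist_le_of_step k u v h := by
    obtain ⟨rfl, hadj⟩ := (hstep k u v).mp h
    exact (SimpleGraph.edist_eq_one_iff_adj.mpr hadj).le
  costPath_of_eq u v h := (congrArg Subtype.val h : (u : X) = v) ▸ .refl _
  costPath_of_adj u v h := .single ((hstep 1 u v).mpr ⟨rfl, h⟩)

theorem contraction {H L : SimpleGraph S} (hS : ∀ ⦃k u v⦄, step k u v → u ∈ S → v ∈ S)
    (hstep : ∀ k (u v : S), step k u v ↔ k = 0 ∧ H.Adj u v ∨ k = 1 ∧ L.Adj u v) :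
    Realizes step ((H ⊔ L).map H.connectedComponentMk) H.connectedComponentMk := by
  have costPath_of_eq ⦃u v : S⦄ (h : H.connectedComponentMk u = H.connectedComponentMk v) :
      CostPath step 0 (u : X) v := by
    obtain ⟨p⟩ := SimpleGraph.ConnectedComponent.eq.mp h
    clear h
    induction p with
    | nil => exact .refl _
    | cons h _ ih => exact (CostPath.single ((hstep 0 _ _).mpr (.inl ⟨rfl, h⟩))).trans ih
  refine ⟨Quot.mk_surjective, hS, fun k u v h => ?_, costPath_of_eq, fun u v h => ?_⟩
  · obtain ⟨rfl, hadj⟩ | ⟨rfl, hadj⟩ := (hstep k u v).mp h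
    · simp [SimpleGraph.ConnectedComponent.eq.mpr hadj.reachable]
    · refine SimpleGraph.edist_le_one_iff_adj_or_eq.mpr (or_iff_not_imp_right.mpr fun hne => ?_)
      exact ⟨hne, u, v, .inr hadj, rfl, rfl⟩
  · obtain ⟨hne, u', v', h | h, hu, hv⟩ := h
    · exact absurd (hu.symm.trans ((SimpleGraph.ConnectedComponent.eq.mpr h.reachable).trans hv))
        hne
    · exact ((costPath_of_eq hu.symm).tail ((hstep 1 _ _).mpr (.inr ⟨rfl, h⟩))).trans
        (costPath_of_eq hv)

end Realizes

/-! ### Moves between words -/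

/-- The two sides `s`, `t` of a braid relation, as a rewriting step `BraidRelation c b k s t` of
cost `k`: commutations cost `c` and long braid relations cost `b`. -/
inductive BraidRelation (c b : ℕ) : ℕ → List ℕ → List ℕ → Prop
  | commute {i j : ℕ} (h : i + 1 < j ∨ j + 1 < i) : BraidRelation c b c [i, j] [j, i]
  | braid (j : ℕ) : BraidRelation c b b [j, j + 1, j] [j + 1, j, j + 1]
  | braid_symm (j : ℕ) : BraidRelation c b b [j + 1, j, j + 1] [j, j + 1, j]

/-- A commutation move (of cost `c`) or a long braid move (of cost `b`). The weights `(1, 1)`,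
`(0, 1)` and `(1, 0)` give the distances in `G`, `C` and `B`. -/
inductive Move (c b : ℕ) : ℕ → List ℕ → List ℕ → Prop
  | mk (x y : List ℕ) {k : ℕ} {s t : List ℕ} (h : BraidRelation c b k s t) :
      Move c b k (x ++ s ++ y) (x ++ t ++ y)

/-- Sequences of moves of a given total cost. -/
abbrev MovePath (c b : ℕ) : ℕ → List ℕ → List ℕ → Prop := CostPath (Move c b)

section Moves

variable {c b k : ℕ} {u v : List ℕ}

theorem move_iff :
    Move c b k u v ↔ k = c ∧ CommutationMove u v ∨ k = b ∧ LongBraidMove u v := by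
  constructor
  · rintro ⟨x, y, h | j | j⟩
    · exact .inl ⟨rfl, x, y, _, _, h, rfl, rfl⟩
    · exact .inr ⟨rfl, x, y, j, .inl ⟨rfl, rfl⟩⟩
    · exact .inr ⟨rfl, x, y, j, .inr ⟨rfl, rfl⟩⟩
  · rintro (⟨rfl, x, y, i, j, h, rfl, rfl⟩ | ⟨rfl, x, y, j, ⟨rfl, rfl⟩ | ⟨rfl, rfl⟩⟩)
    · exact ⟨x, y, .commute h⟩
    · exact ⟨x, y, .braid j⟩
    · exact ⟨x, y, .braid_symm j⟩

theorem BraidRelation.symm (h : BraidRelation c b k u v) : BraidRelation c b k v u := by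
  cases h with
  | commute h => exact .commute h.symm
  | braid j => exact .braid_symm j
  | braid_symm j => exact .braid j

theorem BraidRelation.map_succ (h : BraidRelation c b k u v) :
    BraidRelation c b k (u.map (· + 1)) (v.map (· + 1)) := by
  cases h with
  | @commute i j h => exact .commute (i := i + 1) (j := j + 1) (by omega)
  | braid j => exact .braid (j + 1)
  | braid_symm j => exact .braid_symm (j + 1)

theorem BraidRelation.length_eq (h : BraidRelation c b k u v) : u.length = v.length := by
  cases h <;> rfl

theorem BraidRelation.mem_iff (h : BraidRelation c b k u v) (i : ℕ) : i ∈ u ↔ i ∈ v := by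
  cases h <;> simp only [List.mem_cons] <;> tauto

theorem BraidRelation.move (h : BraidRelation c b k u v) : Move c b k u v := by
  simpa using Move.mk [] [] h

theorem Move.symm (h : Move c b k u v) : Move c b k v u := by
  obtain ⟨x, y, h⟩ := h
  exact ⟨x, y, h.symm⟩

theorem Move.append_append (h : Move c b k u v) (x y : List ℕ) :
    Move c b k (x ++ u ++ y) (x ++ v ++ y) := by
  obtain ⟨x', y', h⟩ := h
  simpa using Move.mk (x ++ x') (y' ++ y) h

theorem Move.map_succ (h : Move c b k u v) : Move c b k (u.map (· + 1)) (v.map (· + 1)) := by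
  obtain ⟨x, y, h⟩ := h
  simpa using Move.mk (x.map (· + 1)) (y.map (· + 1)) h.map_succ

theorem Move.length_eq (h : Move c b k u v) : u.length = v.length := by
  obtain ⟨x, y, h⟩ := h
  simp [h.length_eq]

theorem Move.mem_iff (h : Move c b k u v) (i : ℕ) : i ∈ u ↔ i ∈ v := by
  obtain ⟨x, y, h⟩ := h
  simp [h.mem_iff]

end Moves

namespace CostPath

variable {c b k : ℕ} {u v : List ℕ}

theorem reverse (p : MovePath c b k u v) : MovePath c b k v u := p.symm fun _ _ _ => Move.symm

theorem append_append (p : MovePath c b k u v) (x y : List ℕ) :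
    MovePath c b k (x ++ u ++ y) (x ++ v ++ y) :=
  p.map (x ++ · ++ y) fun _ _ _ h => h.append_append x y

theorem append_left (p : MovePath c b k u v) (x : List ℕ) :
    MovePath c b k (x ++ u) (x ++ v) := by
  simpa using p.append_append x []

theorem append_right (p : MovePath c b k u v) (y : List ℕ) : MovePath c b k (u ++ y) (v ++ y) :=
  p.append_append [] y

theorem cons (p : MovePath c b k u v) (i : ℕ) : MovePath c b k (i :: u) (i :: v) :=
  p.append_left [i]

theorem map_succ (p : MovePath c b k u v) :
    MovePath c b k (u.map (· + 1)) (v.map (· + 1)) :=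
  p.map (List.map (· + 1)) fun _ _ _ => Move.map_succ

end CostPath

theorem movePath_append_singleton {c b i : ℕ} {x : List ℕ}
    (h : ∀ j ∈ x, i + 1 < j ∨ j + 1 < i) :
    MovePath c b (c * x.length) (x ++ [i]) (i :: x) := by
  induction x with
  | nil => exact .refl _
  | cons j x ih =>
    obtain ⟨hj, hx⟩ := List.forall_mem_cons.mp h
    have swap : Move c b c (j :: i :: x) (i :: j :: x) := .mk [] x (.commute hj.symm)
    exact ((ih hx).cons j).tail swap

theorem movePath_range'_append_singleton_of_far {c b s n i : ℕ} (h : s + n < i ∨ i + 1 < s) :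
    MovePath c b (c * n) (List.range' s n ++ [i]) (i :: List.range' s n) := by
  have hfar : ∀ j ∈ List.range' s n, i + 1 < j ∨ j + 1 < i := fun j hj => by
    rw [List.mem_range'_1] at hj
    omega
  simpa using movePath_append_singleton (c := c) (b := b) hfar

theorem movePath_range'_append_singleton_of_mem {c b s n i : ℕ} (hs : s ≤ i) (hn : i + 1 < s + n) :
    MovePath c b (c * (n - 2) + b) (List.range' s n ++ [i]) ((i + 1) :: List.range' s n) := by
  obtain ⟨m, rfl⟩ := Nat.exists_eq_add_of_le hs
  obtain ⟨l, rfl⟩ : ∃ l, n = m + 2 + l := ⟨n - (m + 2), by omega⟩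
  set x := List.range' s m with hx
  set y := List.range' (s + m + 2) l with hy
  set i := s + m with hi
  have split : List.range' s (m + 2 + l) = x ++ [i, i + 1] ++ y := by
    simp [← List.range'_append_1, List.range'_succ, Nat.add_assoc, hx, hy, hi]
  have pass_right : MovePath c b (c * l) (x ++ [i, i + 1] ++ (y ++ [i]))
      (x ++ [i, i + 1, i] ++ y) := by
    simpa using (movePath_range'_append_singleton_of_far (c := c) (b := b)
      (.inr (by omega))).append_left (x ++ [i, i + 1])
  have braid : Move c b b (x ++ [i, i + 1, i] ++ y) (x ++ [i + 1, i, i + 1] ++ y) :=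
    .mk x y (.braid i)
  have pass_left : MovePath c b (c * m) (x ++ [i + 1, i, i + 1] ++ y)
      ((i + 1) :: (x ++ [i, i + 1] ++ y)) := by
    simpa using (movePath_range'_append_singleton_of_far (c := c) (b := b)
      (.inl (by omega))).append_right ([i, i + 1] ++ y)
  rw [split, List.append_assoc]
  refine ((pass_right.tail braid).trans pass_left).cast ?_
  rw [show m + 2 + l - 2 = l + m by omega]
  ring

/-! ### Deleting a wire -/

/-- In the wiring diagram of a word, the letter `i` crosses the wires at positions `i` and `i + 1`.
This is the position after the letter `i` of the wire that is at position `q` before it. -/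
def wireStep (q i : ℕ) : ℕ := if i = q then q + 1 else if i + 1 = q then q - 1 else q

/-- What is left of the letter `i` when the wire at position `q` is deleted: nothing if `i` is a
crossing of that wire, and otherwise the crossing `i`, renumbered if it lies beyond the wire. -/
def wireLetter (q i : ℕ) : List ℕ := if q < i then [i - 1] else if i + 1 < q then [i] else []

/-- The cost of moving the letter `i` across the increasing run `0 1 ⋯ (q - 1)`, unless `i` is a
crossing of the wire at position `q`. -/
def letterCost (c b q i : ℕ) : ℕ :=
  if q < i then c * q else if i + 1 < q then c * (q - 2) + b else 0

/-- The final position in the wiring diagram of a word of the wire that starts at position `q`. -/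
def wirePos (q : ℕ) (w : List ℕ) : ℕ := w.foldl wireStep q

/-- The word obtained by deleting the wire that starts at position `q`. -/
def wireErase : ℕ → List ℕ → List ℕ
  | _, [] => []
  | q, i :: w => wireLetter q i ++ wireErase (wireStep q i) w

/-- The number of times that the wire starting at position `q` moves to the left. -/
def wireDescents : ℕ → List ℕ → ℕ
  | _, [] => 0
  | q, i :: w => (if i + 1 = q then 1 else 0) + wireDescents (wireStep q i) w

/-- The cost of moving all crossings of the wire that starts at position `q` behind the other
letters. -/
def wireCost (c b : ℕ) : ℕ → List ℕ → ℕ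
  | _, [] => 0
  | q, i :: w => letterCost c b q i + wireCost c b (wireStep q i) w

section Wire

variable {c b q i j : ℕ}

theorem wireStep_of_lt (h : q < i) : wireStep q i = q := by grind [wireStep]

theorem wireStep_of_gt (h : i + 1 < q) : wireStep q i = q := by grind [wireStep]

@[simp] theorem wireStep_self (i : ℕ) : wireStep i i = i + 1 := by simp [wireStep]

@[simp] theorem wireStep_succ (i : ℕ) : wireStep (i + 1) i = i := by simp [wireStep]

theorem wireStep_le {a : ℕ} (hq : q ≤ a) (hi : i < a) : wireStep q i ≤ a := by grind [wireStep]

theorem wireLetter_of_lt (h : q < i) : wireLetter q i = [i - 1] := if_pos h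

theorem wireLetter_of_gt (h : i + 1 < q) : wireLetter q i = [i] := by grind [wireLetter]

@[simp] theorem wireLetter_self (i : ℕ) : wireLetter i i = [] := by simp [wireLetter]

@[simp] theorem wireLetter_succ (i : ℕ) : wireLetter (i + 1) i = [] := by simp [wireLetter]

theorem letterCost_of_lt (h : q < i) : letterCost c b q i = c * q := if_pos h

theorem letterCost_of_gt (h : i + 1 < q) : letterCost c b q i = c * (q - 2) + b := by
  grind [letterCost]

@[simp] theorem letterCost_self (i : ℕ) : letterCost c b i i = 0 := by simp [letterCost]

@[simp] theorem letterCost_succ (i : ℕ) : letterCost c b (i + 1) i = 0 := by simp [letterCost]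

@[simp] theorem wirePos_nil (q : ℕ) : wirePos q [] = q := rfl

@[simp] theorem wirePos_cons (q i : ℕ) (w : List ℕ) :
    wirePos q (i :: w) = wirePos (wireStep q i) w := rfl

theorem wirePos_append (q : ℕ) (u v : List ℕ) :
    wirePos q (u ++ v) = wirePos (wirePos q u) v :=
  List.foldl_append

theorem wireErase_append (q : ℕ) (u v : List ℕ) :
    wireErase q (u ++ v) = wireErase q u ++ wireErase (wirePos q u) v := by
  induction u generalizing q with
  | nil => rfl
  | cons i u ih => simp [wireErase, ih]

theorem wireCost_append (c b q : ℕ) (u v : List ℕ) :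
    wireCost c b q (u ++ v) = wireCost c b q u + wireCost c b (wirePos q u) v := by
  induction u generalizing q with
  | nil => simp [wireCost]
  | cons i u ih => simp [wireCost, ih, Nat.add_assoc]

theorem length_add_eq_wire (q : ℕ) (w : List ℕ) :
    w.length + q = (wireErase q w).length + wirePos q w + 2 * wireDescents q w := by
  induction w generalizing q with
  | nil => simp [wireErase, wireDescents]
  | cons i w ih =>
    have letter : (wireLetter q i).length + wireStep q i + 2 * (if i + 1 = q then 1 else 0) =
        q + 1 := by
      grind [wireLetter, wireStep]
    have tail := ih (wireStep q i)
    simp only [wireErase, wirePos_cons, wireDescents, List.length_append, List.length_cons]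
    omega

theorem le_wirePos {w : List ℕ} (h : wireDescents q w = 0) : q ≤ wirePos q w := by
  induction w generalizing q with
  | nil => exact le_rfl
  | cons i w ih =>
    obtain ⟨hi, hw⟩ := Nat.add_eq_zero_iff.mp h
    exact le_trans (by grind [wireStep]) (ih hw)

theorem wirePos_le {a : ℕ} {w : List ℕ} (hq : q ≤ a) (hw : ∀ i ∈ w, i < a) :
    wirePos q w ≤ a := by
  induction w generalizing q with
  | nil => exact hq
  | cons i w ih =>
    obtain ⟨hi, hw⟩ := List.forall_mem_cons.mp hw
    exact ih (wireStep_le hq hi) hw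

theorem succ_lt_of_mem_wireErase {a : ℕ} {w : List ℕ} (hq : q ≤ a) (hw : ∀ i ∈ w, i < a) :
    ∀ i ∈ wireErase q w, i + 1 < a := by
  induction w generalizing q with
  | nil => simp [wireErase]
  | cons i w ih =>
    obtain ⟨hi, hw⟩ := List.forall_mem_cons.mp hw
    have letter : ∀ j ∈ wireLetter q i, j + 1 < a := by grind [wireLetter]
    exact List.forall_mem_append.mpr ⟨letter, ih (wireStep_le hq hi) hw⟩

theorem wirePos_swap (q : ℕ) (h : i + 1 < j ∨ j + 1 < i) :
    wirePos q [i, j] = wirePos q [j, i] := by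
  simp only [wirePos_cons, wirePos_nil]
  grind [wireStep]

theorem wireLetter_wireStep (hq : q = i ∨ q = i + 1) (h : i + 1 < j ∨ j + 1 < i) :
    wireLetter (wireStep q i) j = wireLetter q j := by
  grind [wireLetter, wireStep]

theorem letterCost_wireStep_le (hq : q = i ∨ q = i + 1) (h : i + 1 < j ∨ j + 1 < i) :
    letterCost c b (wireStep q i) j ≤ letterCost c b q j + c ∧
      letterCost c b q j ≤ letterCost c b (wireStep q i) j + c := by
  have mul_le {m n : ℕ} (hmn : m ≤ n + 1) : c * m ≤ c * n + c := Nat.mul_le_mul_left c hmn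
  have hstep : wireStep q i ≤ q + 1 ∧ q ≤ wireStep q i + 1 := by grind [wireStep]
  obtain h | h := h
  · have hj : q < j ∧ wireStep q i < j := by grind [wireStep]
    rw [letterCost_of_lt hj.1, letterCost_of_lt hj.2]
    exact ⟨mul_le hstep.1, mul_le hstep.2⟩
  · have hj : j + 1 < q ∧ j + 1 < wireStep q i := by grind [wireStep]
    rw [letterCost_of_gt hj.1, letterCost_of_gt hj.2, Nat.add_right_comm _ b,
      Nat.add_right_comm _ b]
    exact ⟨Nat.add_le_add_right (mul_le (by omega)) b, Nat.add_le_add_right (mul_le (by omega)) b⟩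

theorem wireErase_swap_of_crossing (hq : q = i ∨ q = i + 1) (h : i + 1 < j ∨ j + 1 < i) :
    wireErase q [i, j] = wireErase q [j, i] ∧
      wireCost c b q [j, i] ≤ wireCost c b q [i, j] + c ∧
      wireCost c b q [i, j] ≤ wireCost c b q [j, i] + c := by
  have hi : wireLetter q i = [] ∧ letterCost c b q i = 0 := by
    obtain rfl | rfl := hq <;> simp
  have hj : wireStep q j = q := by grind [wireStep]
  have hcost := letterCost_wireStep_le (c := c) (b := b) hq h
  simp [wireErase, wireCost, hi, hj, wireLetter_wireStep hq h, hcost]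

theorem exists_movePath_wireErase_swap (h : i + 1 < j ∨ j + 1 < i) :
    ∃ l, MovePath c b l (wireErase q [i, j]) (wireErase q [j, i]) ∧
      l + wireCost c b q [j, i] ≤ c + wireCost c b q [i, j] := by
  by_cases hi : q = i ∨ q = i + 1
  · obtain ⟨herase, hcost, -⟩ := wireErase_swap_of_crossing (c := c) (b := b) hi h
    exact ⟨0, herase ▸ .refl _, by omega⟩
  by_cases hj : q = j ∨ q = j + 1
  · obtain ⟨herase, -, hcost⟩ := wireErase_swap_of_crossing (c := c) (b := b) hj h.symm
    exact ⟨0, herase ▸ .refl _, by omega⟩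
  have letter {i : ℕ} (hi : ¬(q = i ∨ q = i + 1)) :
      wireStep q i = q ∧ wireLetter q i = [if q < i then i - 1 else i] := by
    grind [wireStep, wireLetter]
  refine ⟨c, ?_, ?_⟩
  · simp only [wireErase, letter hi, letter hj, List.append_nil, List.singleton_append]
    exact .single (BraidRelation.commute (by split_ifs <;> omega)).move
  · simp only [wireCost, letter hi, letter hj]
    omega

theorem wirePos_braid (q j : ℕ) : wirePos q [j, j + 1, j] = wirePos q [j + 1, j, j + 1] := by
  simp only [wirePos_cons, wirePos_nil]
  grind [wireStep]

theorem wireErase_braid_of_crossing (hj : j ≤ q) (hq : q ≤ j + 2) :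
    wireErase q [j, j + 1, j] = wireErase q [j + 1, j, j + 1] ∧
      wireCost c b q [j, j + 1, j] ≤ wireCost c b q [j + 1, j, j + 1] + b ∧
      wireCost c b q [j + 1, j, j + 1] ≤ wireCost c b q [j, j + 1, j] + b := by
  obtain rfl | rfl | rfl : q = j ∨ q = j + 1 ∨ q = j + 2 := by omega
  all_goals
    simp [wireErase, wireCost, wireStep_of_lt, wireStep_of_gt, wireLetter_of_lt, wireLetter_of_gt,
      letterCost_of_lt, letterCost_of_gt, Nat.add_assoc]

theorem wireErase_braid_of_far (h : q < j ∨ j + 2 < q) :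
    ∃ m, wireErase q [j, j + 1, j] = [m, m + 1, m] ∧
      wireErase q [j + 1, j, j + 1] = [m + 1, m, m + 1] ∧
      wireCost c b q [j, j + 1, j] = wireCost c b q [j + 1, j, j + 1] := by
  obtain h | h := h
  · obtain ⟨m, rfl⟩ : ∃ m, j = m + 1 := ⟨j - 1, by omega⟩
    have h' : q < m + 1 + 1 := by omega
    exact ⟨m, by
      simp [wireErase, wireCost, wireStep_of_lt, wireLetter_of_lt, letterCost_of_lt, h, h']⟩
  · have h₀ : j + 1 < q := by omega
    exact ⟨j, by
      simp [wireErase, wireCost, wireStep_of_gt, wireLetter_of_gt, letterCost_of_gt, h₀, h]⟩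

theorem BraidRelation.wirePos_eq {k : ℕ} {s t : List ℕ} (h : BraidRelation c b k s t) (q : ℕ) :
    wirePos q s = wirePos q t := by
  cases h with
  | commute h => exact wirePos_swap q h
  | braid j => exact wirePos_braid q j
  | braid_symm j => exact (wirePos_braid q j).symm

theorem BraidRelation.exists_movePath_wireErase {k : ℕ} {s t : List ℕ}
    (h : BraidRelation c b k s t) (q : ℕ) :
    ∃ l, MovePath c b l (wireErase q s) (wireErase q t) ∧
      l + wireCost c b q t ≤ k + wireCost c b q s := by
  cases h with
  | commute h => exact exists_movePath_wireErase_swap h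
  | braid j =>
    by_cases hq : j ≤ q ∧ q ≤ j + 2
    · obtain ⟨herase, -, hcost⟩ := wireErase_braid_of_crossing (c := c) (b := b) hq.1 hq.2
      exact ⟨0, herase ▸ .refl _, by omega⟩
    · obtain ⟨m, hs, ht, hcost⟩ := wireErase_braid_of_far (c := c) (b := b) (q := q) (j := j)
        (by omega)
      exact ⟨b, hs ▸ ht ▸ .single (BraidRelation.braid m).move, by omega⟩
  | braid_symm j =>
    by_cases hq : j ≤ q ∧ q ≤ j + 2
    · obtain ⟨herase, hcost, -⟩ := wireErase_braid_of_crossing (c := c) (b := b) hq.1 hq.2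
      exact ⟨0, herase ▸ .refl _, by omega⟩
    · obtain ⟨m, hs, ht, hcost⟩ := wireErase_braid_of_far (c := c) (b := b) (q := q) (j := j)
        (by omega)
      exact ⟨b, hs ▸ ht ▸ .single (BraidRelation.braid_symm m).move, by omega⟩

theorem Move.exists_movePath_wireErase {k : ℕ} {u v : List ℕ} (h : Move c b k u v) (q : ℕ) :
    ∃ l, MovePath c b l (wireErase q u) (wireErase q v) ∧
      l + wireCost c b q v ≤ k + wireCost c b q u := by
  obtain ⟨x, y, h⟩ := h
  obtain ⟨l, p, hl⟩ := h.exists_movePath_wireErase (wirePos q x)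
  simp only [wireErase_append, wireCost_append, wirePos_append, h.wirePos_eq (wirePos q x)]
  exact ⟨l, p.append_append _ _, by omega⟩

theorem CostPath.exists_movePath_wireErase {k : ℕ} {u v : List ℕ} (p : MovePath c b k u v)
    (q : ℕ) :
    ∃ l, MovePath c b l (wireErase q u) (wireErase q v) ∧
      l + wireCost c b q v ≤ k + wireCost c b q u :=
  p.exists_map_of_potential (wireErase q) (wireCost c b q) fun _ _ _ h =>
    h.exists_movePath_wireErase q

/-! ### Moving a wire to the ends of a word -/

/-- The word `u` with a new wire inserted: the wire starts at position `0` and ends at position `m`,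
and its crossings come after all letters of `u`. -/
def wireLast (m : ℕ) (u : List ℕ) : List ℕ := u.map (· + 1) ++ List.range' 0 m

/-- The word `u` with a new wire inserted: the wire starts at position `0` and ends at position `m`,
and its crossings come before all letters of `u`. -/
def wireFirst (m : ℕ) (u : List ℕ) : List ℕ := List.range' 0 m ++ u

theorem length_wireLast (m : ℕ) (u : List ℕ) : (wireLast m u).length = u.length + m := by
  simp [wireLast]

theorem CostPath.map_wireLast {k : ℕ} {u v : List ℕ} (p : MovePath c b k u v) (m : ℕ) :
    MovePath c b k (wireLast m u) (wireLast m v) :=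
  p.map_succ.append_right _

theorem CostPath.map_wireFirst {k : ℕ} {u v : List ℕ} (p : MovePath c b k u v) (m : ℕ) :
    MovePath c b k (wireFirst m u) (wireFirst m v) :=
  p.append_left _

theorem movePath_range'_append_wireLetter (h : i + 1 ≠ q) :
    MovePath c b (letterCost c b q i) (List.range' 0 q ++ [i])
      ((wireLetter q i).map (· + 1) ++ List.range' 0 (wireStep q i)) := by
  obtain hqi | rfl | hqi : q < i ∨ q = i ∨ i + 1 < q := by omega
  · simpa [wireStep_of_lt, wireLetter_of_lt, letterCost_of_lt, hqi,
      Nat.sub_add_cancel (Nat.one_le_of_lt hqi)] using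
      movePath_range'_append_singleton_of_far (c := c) (b := b) (s := 0) (n := q) (i := i)
        (by omega)
  · simpa [List.range'_1_concat] using .refl _
  · simpa [wireStep_of_gt, wireLetter_of_gt, letterCost_of_gt, hqi] using
      movePath_range'_append_singleton_of_mem (c := c) (b := b) (n := q) (Nat.zero_le i)
        (by omega)

theorem movePath_wireLast {w : List ℕ} (h : wireDescents q w = 0) :
    MovePath c b (wireCost c b q w) (List.range' 0 q ++ w)
      (wireLast (wirePos q w) (wireErase q w)) := by
  induction w generalizing q with
  | nil => simpa [wireCost, wireErase, wireLast] using .refl _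
  | cons i w ih =>
    obtain ⟨hi, hw⟩ := Nat.add_eq_zero_iff.mp h
    have letter := (movePath_range'_append_wireLetter (c := c) (b := b)
      (show i + 1 ≠ q by grind)).append_right w
    have tail := (ih hw).append_left ((wireLetter q i).map (· + 1))
    simp only [List.append_assoc, List.singleton_append] at letter
    simpa [wireCost, wireErase, wireLast] using letter.trans tail

theorem exists_movePath_cons_range' {a : ℕ} (hi : i < a) (hq : q ≤ a) (h : i + 1 ≠ q) :
    ∃ k, MovePath c b k (i :: List.range' (wireStep q i) (a - wireStep q i))
        (List.range' q (a - q) ++ wireLetter q i) ∧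
      k + letterCost c b q i = (wireLetter q i).length * (c * (a - 2) + b) := by
  obtain hqi | rfl | hqi : q < i ∨ q = i ∨ i + 1 < q := by omega
  · obtain ⟨j, rfl⟩ : ∃ j, i = j + 1 := ⟨i - 1, by omega⟩
    rw [wireStep_of_lt hqi, wireLetter_of_lt hqi, letterCost_of_lt hqi]
    refine ⟨_, (movePath_range'_append_singleton_of_mem (by omega) (by omega)).reverse, ?_⟩
    rw [show a - 2 = (a - q - 2) + q by omega, List.length_singleton]
    ring
  · refine ⟨0, ?_, by simp⟩
    rw [wireStep_self, wireLetter_self, List.append_nil, ← List.range'_succ,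
      show a - q = (a - (q + 1)) + 1 by omega]
    exact .refl _
  · rw [wireStep_of_gt hqi, wireLetter_of_gt hqi, letterCost_of_gt hqi]
    refine ⟨_, (movePath_range'_append_singleton_of_far (Or.inr hqi)).reverse, ?_⟩
    rw [show a - 2 = (a - q) + (q - 2) by omega, List.length_singleton]
    ring

theorem exists_movePath_range'_append_wireErase {a : ℕ} {w : List ℕ} (hw : ∀ i ∈ w, i < a)
    (hdesc : wireDescents q w = 0) (hpos : wirePos q w = a) :
    ∃ k, MovePath c b k w (List.range' q (a - q) ++ wireErase q w) ∧
      k + wireCost c b q w = (wireErase q w).length * (c * (a - 2) + b) := by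
  induction w generalizing q with
  | nil =>
    obtain rfl : q = a := hpos
    exact ⟨0, by simpa [wireErase] using .refl _, by simp [wireErase, wireCost]⟩
  | cons i w ih =>
    have hq : q ≤ a := hpos ▸ le_wirePos hdesc
    obtain ⟨hi, hw⟩ := List.forall_mem_cons.mp hw
    obtain ⟨hdesc₀, hdesc⟩ := Nat.add_eq_zero_iff.mp hdesc
    obtain ⟨k, tail, hk⟩ := ih hw hdesc hpos
    obtain ⟨l, letter, hl⟩ := exists_movePath_cons_range' (c := c) (b := b) hi hq (by grind)
    refine ⟨k + l, ?_, ?_⟩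
    · simpa [wireErase] using (tail.cons i).trans (letter.append_right _)
    · simp only [wireErase, wireCost, List.length_append, Nat.add_mul, ← hk, ← hl]
      omega

theorem exists_movePath_wireFirst {a : ℕ} {w : List ℕ} (hw : ∀ i ∈ w, i < a)
    (hdesc : wireDescents 0 w = 0) (hpos : wirePos 0 w = a) :
    ∃ k, MovePath c b k w (wireFirst a (wireErase 0 w)) ∧
      k + wireCost c b 0 w = (wireErase 0 w).length * (c * (a - 2) + b) :=
  exists_movePath_range'_append_wireErase hw hdesc hpos

@[simp] theorem wirePos_range' (s n : ℕ) : wirePos s (List.range' s n) = s + n := by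
  induction n generalizing s with
  | zero => rfl
  | succ n ih => simp [List.range'_succ, ih, Nat.add_assoc, Nat.add_comm 1 n]

@[simp] theorem wireErase_range' (s n : ℕ) : wireErase s (List.range' s n) = [] := by
  induction n generalizing s with
  | zero => rfl
  | succ n ih => simp [List.range'_succ, wireErase, ih]

@[simp] theorem wireCost_range' (c b s n : ℕ) : wireCost c b s (List.range' s n) = 0 := by
  induction n generalizing s with
  | zero => rfl
  | succ n ih => simp [List.range'_succ, wireCost, ih]

theorem wireErase_wireLast (m : ℕ) (u : List ℕ) : wireErase 0 (wireLast m u) = u := by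
  induction u with
  | nil => exact wireErase_range' 0 m
  | cons i u ih =>
    simpa [wireLast, wireErase, wireStep_of_lt, wireLetter_of_lt] using ih

theorem wireCost_wireLast (c b m : ℕ) (u : List ℕ) : wireCost c b 0 (wireLast m u) = 0 := by
  induction u with
  | nil => exact wireCost_range' c b 0 m
  | cons i u ih =>
    simpa [wireLast, wireCost, wireStep_of_lt, letterCost_of_lt] using ih

theorem wireErase_wireFirst {m : ℕ} {u : List ℕ} (hu : ∀ i ∈ u, i + 1 < m) :
    wireErase 0 (wireFirst m u) = u := by
  simp only [wireFirst, wireErase_append, wireErase_range', wirePos_range', Nat.zero_add,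
    List.nil_append]
  induction u with
  | nil => rfl
  | cons i u ih =>
    obtain ⟨hi, hu⟩ := List.forall_mem_cons.mp hu
    simp [wireErase, wireStep_of_gt, wireLetter_of_gt, hi, ih hu]

theorem wireCost_wireFirst {m : ℕ} {u : List ℕ} (hu : ∀ i ∈ u, i + 1 < m) :
    wireCost c b 0 (wireFirst m u) = u.length * (c * (m - 2) + b) := by
  simp only [wireFirst, wireCost_append, wireCost_range', wirePos_range', Nat.zero_add]
  induction u with
  | nil => simp [wireCost]
  | cons i u ih =>
    obtain ⟨hi, hu⟩ := List.forall_mem_cons.mp hu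
    simp [wireCost, wireStep_of_gt, letterCost_of_gt, hi, ih hu, Nat.succ_mul, Nat.add_comm]

end Wire

/-! ### Words and permutations -/

/-- The product of the simple reflections of `𝔖ₙ` named by the letters of a word. -/
def wordProd (n : ℕ) (w : List ℕ) : Equiv.Perm (Fin n) := (w.map (simpleReflection n)).prod

@[simp] theorem wordProd_nil (n : ℕ) : wordProd n [] = 1 := rfl

@[simp] theorem wordProd_cons (n i : ℕ) (w : List ℕ) :
    wordProd n (i :: w) = simpleReflection n i * wordProd n w :=
  List.prod_cons

@[simp] theorem wordProd_append (n : ℕ) (u v : List ℕ) :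
    wordProd n (u ++ v) = wordProd n u * wordProd n v := by
  simp [wordProd]

theorem simpleReflection_val {n i : ℕ} (h : i + 1 < n) (x : Fin n) :
    (simpleReflection n i x : ℕ) =
      if (x : ℕ) = i then i + 1 else if (x : ℕ) = i + 1 then i else x := by
  simp only [simpleReflection, h, dif_pos, Equiv.swap_apply_def, Fin.ext_iff]
  split_ifs <;> rfl

theorem simpleReflection_mul_self (n i : ℕ) : simpleReflection n i * simpleReflection n i = 1 := by
  unfold simpleReflection
  split_ifs <;> simp

theorem simpleReflection_comm {n i j : ℕ} (hi : i + 1 < n) (hj : j + 1 < n)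
    (h : i + 1 < j ∨ j + 1 < i) :
    simpleReflection n i * simpleReflection n j = simpleReflection n j * simpleReflection n i := by
  ext x
  simp only [Equiv.Perm.mul_apply, simpleReflection_val hi, simpleReflection_val hj]
  split_ifs <;> omega

theorem simpleReflection_braid {n j : ℕ} (hj : j + 1 < n) (hj' : j + 1 + 1 < n) :
    simpleReflection n j * (simpleReflection n (j + 1) * simpleReflection n j) =
      simpleReflection n (j + 1) * (simpleReflection n j * simpleReflection n (j + 1)) := by
  ext x
  simp only [Equiv.Perm.mul_apply, simpleReflection_val hj, simpleReflection_val hj']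
  split_ifs <;> omega

section Word

variable {c b k n : ℕ} {u v : List ℕ} {π : Equiv.Perm (Fin n)}

theorem BraidRelation.wordProd_eq (h : BraidRelation c b k u v) (hu : ∀ i ∈ u, i + 1 < n) :
    wordProd n u = wordProd n v := by
  cases h with
  | commute h => simpa using simpleReflection_comm (hu _ (by simp)) (hu _ (by simp)) h
  | braid j => simpa using simpleReflection_braid (hu j (by simp)) (hu (j + 1) (by simp))
  | braid_symm j =>
    simpa using (simpleReflection_braid (hu j (by simp)) (hu (j + 1) (by simp))).symm

theorem Move.isWordFor (h : Move c b k u v) (hu : IsWordFor π u) : IsWordFor π v := by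
  refine ⟨fun i hi => hu.1 i ((h.mem_iff i).mpr hi), Eq.trans ?_ hu.2⟩
  obtain ⟨x, y, h⟩ := h
  have hs := h.wordProd_eq (n := n) fun i hi => hu.1 i (by simp [hi])
  change wordProd n _ = wordProd n _
  simp only [wordProd_append, hs]

theorem Move.mem_R (h : Move c b k u v) (hu : u ∈ R π) : v ∈ R π :=
  ⟨h.isWordFor hu.1, h.length_eq ▸ hu.2⟩

theorem CostPath.wordProd_eq (p : MovePath c b k u v) (hu : ∀ i ∈ u, i + 1 < n) :
    wordProd n u = wordProd n v :=
  (p.mem_of_mem (S := {w | IsWordFor (wordProd n u) w}) (fun _ _ _ h => h.isWordFor)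
    ⟨hu, rfl⟩).2.symm

end Word

/-- The embedding `𝔖ₐ → 𝔖ₐ₊₁` onto the permutations that fix `0`. -/
noncomputable def shiftHom (a : ℕ) : Equiv.Perm (Fin a) →* Equiv.Perm (Fin (a + 1)) :=
  Equiv.Perm.viaEmbeddingHom (Fin.succEmb a)

/-- The permutation whose one-line notation is that of `α`, with all values raised by one and the
value `0` inserted at position `m`. -/
noncomputable def insertZero {a : ℕ} (m : Fin (a + 1)) (α : Equiv.Perm (Fin a)) :
    Equiv.Perm (Fin (a + 1)) :=
  shiftHom a α * m.cycleRange

section Insert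

variable {a : ℕ}

theorem shiftHom_injective (a : ℕ) : Function.Injective (shiftHom a) :=
  Equiv.Perm.viaEmbeddingHom_injective _

theorem shiftHom_succ (α : Equiv.Perm (Fin a)) (x : Fin a) :
    shiftHom a α x.succ = (α x).succ :=
  α.viaEmbedding_apply (Fin.succEmb a) x

theorem shiftHom_zero (α : Equiv.Perm (Fin a)) : shiftHom a α 0 = 0 :=
  α.viaEmbedding_apply_of_notMem (Fin.succEmb a) 0 (by simp)

theorem shiftHom_simpleReflection {i : ℕ} (h : i + 1 < a) :
    shiftHom a (simpleReflection a i) = simpleReflection (a + 1) (i + 1) := by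
  ext x
  rw [simpleReflection_val (Nat.succ_lt_succ h)]
  cases x using Fin.cases with
  | zero => simp [shiftHom_zero]
  | succ x =>
    rw [shiftHom_succ, Fin.val_succ, simpleReflection_val h, Fin.val_succ]
    split_ifs <;> omega

theorem shiftHom_wordProd {u : List ℕ} (h : ∀ i ∈ u, i + 1 < a) :
    shiftHom a (wordProd a u) = wordProd (a + 1) (u.map (· + 1)) := by
  induction u with
  | nil => simp
  | cons i u ih =>
    obtain ⟨hi, hu⟩ := List.forall_mem_cons.mp h
    simp [shiftHom_simpleReflection hi, ih hu]

@[simp] theorem insertZero_self (m : Fin (a + 1)) (α : Equiv.Perm (Fin a)) :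
    insertZero m α m = 0 := by
  simp [insertZero, shiftHom_zero]

@[simp] theorem insertZero_succAbove (m : Fin (a + 1)) (α : Equiv.Perm (Fin a)) (x : Fin a) :
    insertZero m α (m.succAbove x) = (α x).succ := by
  simp [insertZero, shiftHom_succ]

theorem insertZero_inj {m m' : Fin (a + 1)} {α α' : Equiv.Perm (Fin a)} :
    insertZero m α = insertZero m' α' ↔ m = m' ∧ α = α' := by
  refine ⟨fun h => ?_, fun ⟨hm, hα⟩ => hm ▸ hα ▸ rfl⟩
  have hm : m = m' := (insertZero m α).injective (by rw [insertZero_self, h, insertZero_self])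
  subst hm
  exact ⟨rfl, shiftHom_injective a (mul_right_cancel h)⟩

theorem inflation21_one (α : Equiv.Perm (Fin a)) :
    inflation21 α (1 : Equiv.Perm (Fin 1)) = insertZero (Fin.last a) α := by
  ext x
  cases x using Fin.lastCases with
  | last =>
    rw [insertZero_self]
    exact inflation21_natAdd α 1 0
  | cast x =>
    have hx := insertZero_succAbove (Fin.last a) α x
    rw [Fin.succAbove_last_apply] at hx
    rw [hx, Fin.val_succ]
    exact (inflation21_castAdd α 1 x).trans (Nat.add_comm _ _)

theorem cycleRange_val {n : ℕ} (m x : Fin n) :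
    (m.cycleRange x : ℕ) = if (x : ℕ) < m then (x : ℕ) + 1 else if (x : ℕ) = m then 0 else x := by
  obtain h | h := le_or_gt x m
  · grind [Fin.coe_cycleRange_of_le h]
  · grind [Fin.cycleRange_of_gt h]

theorem wordProd_range' {n m : ℕ} (hm : m < n) :
    wordProd n (List.range' 0 m) = Fin.cycleRange ⟨m, hm⟩ := by
  induction m with
  | zero => simp
  | succ m ih =>
    ext x
    rw [List.range'_1_concat, wordProd_append, ih (Nat.lt_of_succ_lt hm), Nat.zero_add,
      wordProd_cons, wordProd_nil, mul_one, Equiv.Perm.mul_apply, cycleRange_val, cycleRange_val,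
      simpleReflection_val hm]
    dsimp only
    split_ifs <;> omega

theorem wordProd_wireLast {m : ℕ} {u : List ℕ} (hm : m < a + 1) (hu : ∀ i ∈ u, i + 1 < a) :
    wordProd (a + 1) (wireLast m u) = insertZero ⟨m, hm⟩ (wordProd a u) := by
  rw [wireLast, wordProd_append, insertZero, shiftHom_wordProd hu, wordProd_range' hm]

theorem wordProd_range'_append {q : ℕ} {w : List ℕ} (hq : q ≤ a) (hw : ∀ i ∈ w, i < a) :
    wordProd (a + 1) (List.range' 0 q ++ w) =
      wordProd (a + 1) (wireLast (wirePos q w) (wireErase q w)) := by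
  induction w generalizing q with
  | nil => simp [wireErase, wireLast]
  | cons i w ih =>
    obtain ⟨hi, hw⟩ := List.forall_mem_cons.mp hw
    have tail := ih (wireStep_le hq hi) hw
    have letter : wordProd (a + 1) (List.range' 0 q ++ [i]) = wordProd (a + 1)
        ((wireLetter q i).map (· + 1) ++ List.range' 0 (wireStep q i)) := by
      by_cases h : i + 1 = q
      · subst h
        simp [List.range'_1_concat, simpleReflection_mul_self]
      · refine (movePath_range'_append_wireLetter (c := 0) (b := 0) h).wordProd_eq ?_
        grind
    simp only [wireLast, wireErase, wirePos_cons, wordProd_append, wordProd_cons, wordProd_nil,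
      List.map_append, mul_one] at letter tail ⊢
    rw [← mul_assoc, letter, mul_assoc, tail, mul_assoc]

theorem wordProd_eq_insertZero {w : List ℕ} (hw : ∀ i ∈ w, i < a) :
    wordProd (a + 1) w = insertZero ⟨wirePos 0 w, Nat.lt_succ_of_le (wirePos_le a.zero_le hw)⟩
      (wordProd a (wireErase 0 w)) := by
  rw [← wordProd_wireLast _ (succ_lt_of_mem_wireErase a.zero_le hw)]
  exact wordProd_range'_append a.zero_le hw

end Insert

/-! ### Reduced words -/

section Reduced

variable {n : ℕ} {π : Equiv.Perm (Fin n)} {w : List ℕ}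

theorem exists_isWordFor (π : Equiv.Perm (Fin n)) : ∃ w, IsWordFor π w := by
  obtain _ | n := n
  · exact ⟨[], by simp, Subsingleton.elim _ _⟩
  have hπ : π ∈ Submonoid.closure (Set.range fun i : Fin n => Equiv.swap i.castSucc i.succ) :=
    Equiv.Perm.mclosure_swap_castSucc_succ n ▸ Submonoid.mem_top π
  induction hπ using Submonoid.closure_induction with
  | mem _ hs =>
    obtain ⟨i, rfl⟩ := hs
    have hi : (i : ℕ) + 1 < n + 1 := Nat.succ_lt_succ i.isLt
    exact ⟨[i], by simp, (wordProd_cons _ _ _).trans ((mul_one _).trans (dif_pos hi))⟩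
  | one => exact ⟨[], by simp, rfl⟩
  | mul _ _ _ _ hσ hτ =>
    obtain ⟨u, hu, rfl⟩ := hσ
    obtain ⟨v, hv, rfl⟩ := hτ
    exact ⟨u ++ v, List.forall_mem_append.mpr ⟨hu, hv⟩, by simp⟩

theorem R_nonempty (π : Equiv.Perm (Fin n)) : (R π).Nonempty := by
  obtain ⟨w, hw, hmin⟩ :=
    exists_minimalFor_of_wellFoundedLT (IsWordFor π) List.length (exists_isWordFor π)
  exact ⟨w, hw, fun w' hw' => (le_total w.length w'.length).elim id (hmin hw')⟩

theorem IsWordFor.ell_le_length (hw : IsWordFor π w) : ell π ≤ w.length :=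
  Nat.sInf_le ⟨w, hw, rfl⟩

theorem length_eq_ell (hw : w ∈ R π) : w.length = ell π := by
  refine le_antisymm (le_csInf ⟨_, w, hw.1, rfl⟩ ?_) hw.1.ell_le_length
  rintro _ ⟨w', hw', rfl⟩
  exact hw.2 w' hw'

theorem finite_R (π : Equiv.Perm (Fin n)) : (R π).Finite := by
  refine ((List.finite_length_eq (Fin n) (ell π)).image (List.map Fin.val)).subset fun w hw => ?_
  have hlt : ∀ i ∈ w, i < n := fun i hi => Nat.lt_of_succ_lt (hw.1.1 i hi)
  exact ⟨w.pmap Fin.mk hlt, by simp [length_eq_ell hw], by simp [List.map_pmap]⟩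

end Reduced

section ReducedInsertZero

variable {c b a : ℕ} {m : Fin (a + 1)} {α : Equiv.Perm (Fin a)} {u w : List ℕ}

theorem IsWordFor.lt_of_mem {π : Equiv.Perm (Fin (a + 1))} (hw : IsWordFor π w) :
    ∀ i ∈ w, i < a :=
  fun i hi => Nat.lt_of_succ_lt_succ (hw.1 i hi)

theorem exists_eq_insertZero (π : Equiv.Perm (Fin (a + 1))) : ∃ m α, π = insertZero m α := by
  obtain ⟨w, hw⟩ := exists_isWordFor π
  exact ⟨_, _, hw.2.symm.trans (wordProd_eq_insertZero hw.lt_of_mem)⟩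

theorem IsWordFor.wirePos_eq (hw : IsWordFor (insertZero m α) w) : wirePos 0 w = m :=
  congrArg Fin.val (insertZero_inj.mp ((wordProd_eq_insertZero hw.lt_of_mem).symm.trans hw.2)).1

theorem IsWordFor.wireErase (hw : IsWordFor (insertZero m α) w) :
    IsWordFor α (wireErase 0 w) :=
  ⟨succ_lt_of_mem_wireErase a.zero_le hw.lt_of_mem,
    (insertZero_inj.mp ((wordProd_eq_insertZero hw.lt_of_mem).symm.trans hw.2)).2⟩

theorem IsWordFor.wireLast (hu : IsWordFor α u) (m : Fin (a + 1)) :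
    IsWordFor (insertZero m α) (wireLast m u) := by
  refine ⟨fun i hi => ?_, (wordProd_wireLast m.isLt hu.1).trans (congrArg _ hu.2)⟩
  have := hu.1
  grind [ReducedWords.wireLast]

theorem wireLast_mem_R (hu : u ∈ R α) (m : Fin (a + 1)) : wireLast m u ∈ R (insertZero m α) := by
  refine ⟨hu.1.wireLast m, fun w hw => ?_⟩
  have hmin := hu.2 _ hw.wireErase
  have hlen := length_add_eq_wire 0 w
  rw [hw.wirePos_eq] at hlen
  rw [length_wireLast]
  omega

theorem ell_insertZero (m : Fin (a + 1)) (α : Equiv.Perm (Fin a)) :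
    ell (insertZero m α) = ell α + m := by
  obtain ⟨u, hu⟩ := R_nonempty α
  rw [← length_eq_ell (wireLast_mem_R hu m), length_wireLast, length_eq_ell hu]

theorem ell_eq_length_wireErase_add (hw : w ∈ R (insertZero m α)) :
    ell α = (wireErase 0 w).length + 2 * wireDescents 0 w := by
  have hlen := length_add_eq_wire 0 w
  rw [length_eq_ell hw, ell_insertZero, hw.1.wirePos_eq] at hlen
  omega

theorem wireErase_mem_R (hw : w ∈ R (insertZero m α)) : wireErase 0 w ∈ R α :=
  ⟨hw.1.wireErase, fun _ hu =>
    (Nat.le.intro (ell_eq_length_wireErase_add hw).symm).trans hu.ell_le_length⟩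

theorem wireDescents_eq_zero (hw : w ∈ R (insertZero m α)) : wireDescents 0 w = 0 := by
  have hell := ell_eq_length_wireErase_add hw
  rw [length_eq_ell (wireErase_mem_R hw)] at hell
  omega

theorem movePath_wireLast_of_mem_R (hw : w ∈ R (insertZero m α)) :
    MovePath c b (wireCost c b 0 w) w (wireLast m (wireErase 0 w)) :=
  hw.1.wirePos_eq ▸ movePath_wireLast (wireDescents_eq_zero hw)

theorem exists_movePath_wireFirst_of_mem_R (hw : w ∈ R (insertZero (Fin.last a) α)) :
    ∃ k, MovePath c b k w (wireFirst a (wireErase 0 w)) ∧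
      k + wireCost c b 0 w = ell α * (c * (a - 2) + b) :=
  length_eq_ell (wireErase_mem_R hw) ▸
    exists_movePath_wireFirst hw.1.lt_of_mem (wireDescents_eq_zero hw) hw.1.wirePos_eq

theorem wireFirst_mem_R (hu : u ∈ R α) : wireFirst a u ∈ R (insertZero (Fin.last a) α) := by
  have hlast : wireLast a u ∈ _ := wireLast_mem_R hu (Fin.last a)
  obtain ⟨k, p, -⟩ := exists_movePath_wireFirst_of_mem_R (c := 0) (b := 0) hlast
  rw [wireErase_wireLast] at p
  exact p.mem_of_mem (fun _ _ _ h => h.mem_R) hlast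

end ReducedInsertZero

theorem exists_movePath (c b : ℕ) {n : ℕ} {π : Equiv.Perm (Fin n)} {u v : List ℕ}
    (hu : u ∈ R π) (hv : v ∈ R π) : ∃ k, MovePath c b k u v := by
  induction n generalizing u v with
  | zero =>
    have eq_nil {w : List ℕ} (hw : w ∈ R π) : w = [] :=
      List.eq_nil_iff_forall_not_mem.mpr fun i hi => Nat.not_lt_zero _ (hw.1.1 i hi)
    rw [eq_nil hu, eq_nil hv]
    exact ⟨0, .refl _⟩
  | succ a ih =>
    obtain ⟨m, α, rfl⟩ := exists_eq_insertZero π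
    obtain ⟨k, p⟩ := ih (wireErase_mem_R hu) (wireErase_mem_R hv)
    exact ⟨_, ((movePath_wireLast_of_mem_R hu).trans (p.map_wireLast m)).trans
      (movePath_wireLast_of_mem_R hv).reverse⟩

/-! ### Diameters -/

section Diameter

variable {c b a D : ℕ} {α : Equiv.Perm (Fin a)}

theorem exists_movePath_le_of_mem_R_insertZero {k : ℕ} {w w' : List ℕ}
    (hw : w ∈ R (insertZero (Fin.last a) α)) (hw' : w' ∈ R (insertZero (Fin.last a) α))
    (p : MovePath c b k (wireErase 0 w) (wireErase 0 w')) :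
    ∃ l ≤ k + ell α * (c * (a - 2) + b), MovePath c b l w w' := by
  obtain ⟨l, first, hl⟩ := exists_movePath_wireFirst_of_mem_R (c := c) (b := b) hw
  obtain ⟨l', first', hl'⟩ := exists_movePath_wireFirst_of_mem_R (c := c) (b := b) hw'
  have routeLast := ((movePath_wireLast_of_mem_R hw).trans (p.map_wireLast a)).trans
    (movePath_wireLast_of_mem_R hw').reverse
  have routeFirst := (first.trans (p.map_wireFirst a)).trans first'.reverse
  by_cases h : wireCost c b 0 w + wireCost c b 0 w' ≤ ell α * (c * (a - 2) + b)
  · exact ⟨_, by omega, routeLast⟩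
  · exact ⟨_, by omega, routeFirst⟩

theorem exists_movePath_add_le_of_wireLast_wireFirst {k : ℕ} {u v : List ℕ} (hv : v ∈ R α)
    (p : MovePath c b k (wireLast a u) (wireFirst a v)) :
    ∃ l, MovePath c b l u v ∧ l + ell α * (c * (a - 2) + b) ≤ k := by
  obtain ⟨l, q, hl⟩ := p.exists_movePath_wireErase 0
  rw [wireErase_wireLast, wireErase_wireFirst hv.1.1] at q
  rw [wireCost_wireLast, wireCost_wireFirst hv.1.1, length_eq_ell hv] at hl
  exact ⟨l, q, hl⟩

theorem IsCostDiam.insertZero_last (h : IsCostDiam (Move c b) (R α) D) :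
    IsCostDiam (Move c b) (R (insertZero (Fin.last a) α)) (D + ell α * (c * (a - 2) + b)) := by
  obtain ⟨hle, u, hu, v, hv, hge⟩ := h
  refine ⟨fun w hw w' hw' => ?_, wireLast a u, wireLast_mem_R hu (Fin.last a), wireFirst a v,
    wireFirst_mem_R hv, fun k p => ?_⟩
  · obtain ⟨k, hk, p⟩ := hle _ (wireErase_mem_R hw) _ (wireErase_mem_R hw')
    obtain ⟨l, hl, q⟩ := exists_movePath_le_of_mem_R_insertZero hw hw' p
    exact ⟨l, hl.trans (Nat.add_le_add_right hk _), q⟩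
  · obtain ⟨l, q, hl⟩ := exists_movePath_add_le_of_wireLast_wireFirst hv p
    exact (Nat.add_le_add_right (hge l q) _).trans hl

theorem realizes_G {n : ℕ} (π : Equiv.Perm (Fin n)) :
    Realizes (Move 1 1) (G π) (id : R π → R π) :=
  .of_adj_iff (fun _ _ _ h => h.mem_R) fun _ _ _ => move_iff.trans and_or_left.symm

theorem realizes_C {n : ℕ} (π : Equiv.Perm (Fin n)) :
    Realizes (Move 0 1) (C π) (commutationEdges π).connectedComponentMk :=
  .contraction (fun _ _ _ h => h.mem_R) fun _ _ _ => move_iff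

theorem realizes_B {n : ℕ} (π : Equiv.Perm (Fin n)) :
    Realizes (Move 1 0) (B π) (longBraidEdges π).connectedComponentMk := by
  rw [B, G, sup_comm]
  exact .contraction (fun _ _ _ h => h.mem_R) fun _ _ _ => move_iff.trans or_comm

theorem diam_inflation21 {V V' : Type*} {K : SimpleGraph V} {K' : SimpleGraph V'} {f : R α → V}
    {f' : R (inflation21 α (1 : Equiv.Perm (Fin 1))) → V'} (h : Realizes (Move c b) K f)
    (h' : Realizes (Move c b) K' f') :
    K.Connected ∧ K'.Connected ∧ K'.diam = K.diam + ell α * (c * (a - 2) + b) := by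
  obtain ⟨D, hD⟩ : ∃ D, IsCostDiam (Move c b) (R α) D :=
    exists_isCostDiam (finite_R α) (R_nonempty α) fun _ hu _ hv => exists_movePath c b hu hv
  obtain ⟨hconn, hdiam⟩ := h.connected_and_diam_eq hD
  obtain ⟨hconn', hdiam'⟩ := h'.connected_and_diam_eq (inflation21_one α ▸ hD.insertZero_last)
  exact ⟨hconn, hconn', by rw [hdiam, hdiam']⟩

theorem ell_mul_cast_sub_two (α : Equiv.Perm (Fin a)) :
    (ell α : ℤ) * ((a - 2 : ℕ) : ℤ) = ell α * ((a : ℤ) - 2) := by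
  obtain ⟨_ | ⟨i, w⟩, hw⟩ := R_nonempty α
  · simp [← length_eq_ell hw]
  · have hi : i + 1 < a := hw.1.1 i (by simp)
    rw [Nat.cast_sub (by omega), Nat.cast_two]

end Diameter

end ReducedWords

theorem corollary4p7 (a : ℕ) (α : Equiv.Perm (Fin a)) (π : Equiv.Perm (Fin (a + 1)))
    (hπ : π = ReducedWords.inflation21 α (1 : Equiv.Perm (Fin 1))) :
    -- all the graphs are connected, so that `diam` is the maximum of the distances
    ((ReducedWords.G α).Connected ∧ (ReducedWords.C α).Connected ∧ (ReducedWords.B α).Connected ∧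
      (ReducedWords.G π).Connected ∧ (ReducedWords.C π).Connected ∧
      (ReducedWords.B π).Connected) ∧
    ((ReducedWords.G π).diam : ℤ) =
      (ReducedWords.G α).diam + (ReducedWords.ell α : ℤ) * ((a : ℤ) - 1) ∧
    (ReducedWords.C π).diam = (ReducedWords.C α).diam + ReducedWords.ell α ∧
    ((ReducedWords.B π).diam : ℤ) =
      (ReducedWords.B α).diam + (ReducedWords.ell α : ℤ) * ((a : ℤ) - 2) := by
  open ReducedWords in
  subst hπ
  obtain ⟨hG, hG', diamG⟩ := diam_inflation21 (realizes_G α) (realizes_G _)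
  obtain ⟨hC, hC', diamC⟩ := diam_inflation21 (realizes_C α) (realizes_C _)
  obtain ⟨hB, hB', diamB⟩ := diam_inflation21 (realizes_B α) (realizes_B _)
  have hcast := ell_mul_cast_sub_two α
  refine ⟨⟨hG, hC, hB, hG', hC', hB'⟩, ?_, ?_, ?_⟩
  · rw [diamG]
    push_cast
    linear_combination hcast
  · rw [diamC, Nat.zero_mul, Nat.zero_add, Nat.mul_one]
  · rw [diamB]
    push_cast
    linear_combination hcast
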